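/- Let $2\le s\le d$ be integers and $1\le p<\infty$. A convolutional network of depth $J\ge 1$ and sparsity $s$ is a function $f:\mathbb{R}^d\to\mathbb{R}$, $f=W\circ f^{(J)}$, where $f^{(0)}(x)=x$, $f^{(j)}(x)=\sigma\bullet\big(w^{(j)}\star f^{(j-1)}(x)-b^{(j)}\big)\in\mathbb{R}^{d+sj}$ for $j=1,\dots,J$; here $\sigma(t)=\max\{0,t\}$ acts componentwise, $b^{(j)}\in\mathbb{R}^{d+sj}$, $w^{(j)}=(w^{(j)}_k)_{k\in\mathbb{Z}}$ is a real mask with $w^{(j)}_k\ne 0$ only if $0\le k\le s$, $(w\star v)_i=\sum_j w_{i-j}v_j$, and $W:\mathbb{R}^{d+sJ}\to\mathbb{R}$ is affine. Let $\operatorname{Conv}^s$ be the set of all such $f$, of arbitrary depth $J\ge1$. Let $\mu$ be a $\sigma$-finite Borel measure on $\mathbb{R}^d$, absolutely continuous with respect to Lebesgue measure, and let $(K_n)_{n\ge1}$ be compact sets with $0<\mu(K_n)<\infty$, $\mu(\mathbb{R}^d\setminus\bigcup_n K_n)=0$ and $\mu(K_n\cap K_m)=0$ for $n\ne m$. Let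 $L^p_{\mu,\mathrm{loc}}$ be the set of ($\mu$-a.e. classes of) measurable functions $\mathbb{R}^d\to\mathbb{R}$ that are $p$-integrable on every compact set, with its usual topology $\tau_{\mathrm{loc}}$ of $L^p$-convergence on compact sets. For $n\ge1$ let $L^p_{\mu:n}$ be the set of $f\in L^p_{\mu,\mathrm{loc}}$ with essential support in $\bigcup_{i\le n}K_i$, normed by $\max_{i\le n}\big(\int\|f I_{K_i}\|^p\,d\mu\big)^{1/p}$; let $\tau_\infty$ be the direct limit topology on $\bigcup_n L^p_{\mu:n}$ (the finest topology for which all inclusions of the $L^p_{\mu:n}$ are continuous). $L^p_{\mu,\mathrm{strict}}$ is the set $L^p_{\mu,\mathrm{loc}}$ with the smallest topology containing $\tau_\infty$, the norm topology of $L^p_\mu$, and $\tau_{\mathrm{loc}}$. The architope upgrade $\operatorname{Conv}^s\text{-tope}$ is the set of elements of $L^p_{\mu,\mathrm{loc}}$ of the form $\sum_{i=1}^n\beta_i I_{K_i}f_i+\beta_0 f_0 I_{\mathbb{R}^d\setminus\bigcup_{i\le n}K_i}$ with $n\ge1$, $f_0,\dots,f_n\in\operatorname{Conv}^s$, and $\beta_0,\dots,\beta_n\in\mathbb{R}$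 not all zero. $\operatorname{Conv}^s$ is also viewed as the set of those elements of $L^p_{\mu,\mathrm{loc}}$ that have a representative in $\operatorname{Conv}^s$. Then: (o) $\operatorname{Conv}^s$ is dense in $L^p_\nu(\mathbb{R}^d,\mathbb{R})$ for every finite compactly supported Borel measure $\nu$ on $\mathbb{R}^d$. (i) $\operatorname{Conv}^s\text{-tope}$ is dense in $L^p_{\mu,\mathrm{strict}}(\mathbb{R}^d,\mathbb{R})$. (ii) For every $\delta>0$ and $f\in L^p_\mu(\mathbb{R}^d,\mathbb{R})$ there is $f^\delta\in\operatorname{Conv}^s\text{-tope}$ with $\int|f-f^\delta|^p\,d\mu<\delta$. (iii) $\operatorname{Conv}^s\text{-tope}$ is dense for every topology on $L^p_{\mu,\mathrm{loc}}(\mathbb{R}^d,\mathbb{R})$ for which $\operatorname{Conv}^s$ is dense. The converse fails whenever $\operatorname{Conv}^s\ne\operatorname{Conv}^s\text{-tope}$ as subsets of $L^p_{\mu,\mathrm{loc}}$: there is then a topology on $L^p_{\mu,\mathrm{loc}}$ for which $\operatorname{Conv}^s\text{-tope}$ is dense but $\operatorname{Conv}^s$ is not. The two sets do differ whenever every non-empty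 open set has positive $\mu$-measure (for instance, when $\mu$ is Lebesgue measure). -/

import Mathlib

open MeasureTheory
open scoped ENNReal Topology

namespace Architope

/-! ## Deep sparse convolutional networks -/

/-- The convolution `(w ⋆ v) i = ∑ j, w (i - j) * v j` of a mask with a vector `(v 0, …, v (m-1))`,
restricted to the indices `0, …, n - 1`. -/
def convolve {m n : ℕ} (w : ℤ → ℝ) (v : Fin m → ℝ) : Fin n → ℝ :=
  fun i => ∑ j : Fin m, w ((i : ℤ) - (j : ℤ)) * v j

/-- The `j`-th layer `f⁽ʲ⁾(x) ∈ ℝ^(d + s j)` of the ReLU convolutional network with masks `w⁽ʲ⁾` and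
biases `b⁽ʲ⁾`: `f⁽⁰⁾(x) = x` and `f⁽ʲ⁾ = σ • (w⁽ʲ⁾ ⋆ f⁽ʲ⁻¹⁾ - b⁽ʲ⁾)` with `σ(t) = max 0 t`. -/
def convLayer {d : ℕ} (s : ℕ) (w : ℕ → ℤ → ℝ) (b : (j : ℕ) → Fin (d + s * j) → ℝ)
    (x : Fin d → ℝ) : (j : ℕ) → Fin (d + s * j) → ℝ
  | 0 => x
  | j + 1 => fun i => max 0 (convolve (w (j + 1)) (convLayer s w b x j) i - b (j + 1) i)

/-- `Conv^s`: all convolutional networks from `ℝ^d` to `ℝ` of sparsity `s` and arbitrary positive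
depth `J`, i.e. all functions `W ∘ f⁽ᴶ⁾` with `W` affine and masks supported in `{0, …, s}`. -/
def Conv (d s : ℕ) : Set C(Fin d → ℝ, ℝ) :=
  {f | ∃ (J : ℕ) (w : ℕ → ℤ → ℝ) (b : (j : ℕ) → Fin (d + s * j) → ℝ)
      (W : (Fin (d + s * J) → ℝ) →ᵃ[ℝ] ℝ),
      1 ≤ J ∧ (∀ j k, w j k ≠ 0 → 0 ≤ k ∧ k ≤ (s : ℤ)) ∧
      ∀ x, f x = W (convLayer s w b x J)}

/-! ## Partitions -/

/-- A partition of `ℝ^d` for `μ`: compact sets covering `ℝ^d` up to a `μ`-null set, with `μ`-null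
pairwise intersections. (The set written `K_{n+1}` in 1-based notation is `K n` here.) -/
structure IsPartition {d : ℕ} (μ : Measure (Fin d → ℝ)) (K : ℕ → Set (Fin d → ℝ)) : Prop where
  isCompact : ∀ n, IsCompact (K n)
  cover : μ (⋃ n, K n)ᶜ = 0
  inter : ∀ n m, n ≠ m → μ (K n ∩ K m) = 0

/-! ## Locally `p`-integrable functions -/

section Spaces

variable {d : ℕ} (Y : Type*) [NormedAddCommGroup Y] (p : ℝ≥0∞) (μ : Measure (Fin d → ℝ))

/-- `L^p_{μ,loc}(ℝ^d, Y)`: `μ`-a.e. classes of measurable functions that are `p`-integrable on every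
compact set. -/
abbrev LpLoc : Type _ :=
  {f : (Fin d → ℝ) →ₘ[μ] Y // ∀ C : Set (Fin d → ℝ), IsCompact C → MemLp f p (μ.restrict C)}

/-- The usual topology of `L^p_{μ,loc}`, given by the seminorms
`f ↦ ‖f‖_{L^p(C)}` with `C` compact (a directed family, so that balls for single seminorms form
a neighbourhood base). -/
@[reducible] def locTopology : TopologicalSpace (LpLoc Y p μ) where
  IsOpen U := ∀ f ∈ U, ∃ C : Set (Fin d → ℝ), IsCompact C ∧ ∃ ε : ℝ≥0∞, 0 < ε ∧
    ∀ g : LpLoc Y p μ, eLpNorm (fun x => g.1 x - f.1 x) p (μ.restrict C) < ε → g ∈ U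
  isOpen_univ := fun _ _ => ⟨∅, isCompact_empty, 1, one_pos, fun _ _ => trivial⟩
  isOpen_inter := by
    rintro U V hU hV f ⟨hfU, hfV⟩
    obtain ⟨C, hC, ε, hε, h⟩ := hU f hfU
    obtain ⟨C', hC', ε', hε', h'⟩ := hV f hfV
    refine ⟨C ∪ C', hC.union hC', min ε ε', lt_min hε hε', fun g hg => ⟨h g ?_, h' g ?_⟩⟩
    · exact ((eLpNorm_mono_measure _ (Measure.restrict_mono_set μ Set.subset_union_left)).trans_lt
        hg).trans_le (min_le_left _ _)
    · exact ((eLpNorm_mono_measure _ (Measure.restrict_mono_set μ Set.subset_union_right)).trans_lt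
        hg).trans_le (min_le_right _ _)
  isOpen_sUnion := by
    rintro S hS f ⟨U, hU, hf⟩
    obtain ⟨C, hC, ε, hε, h⟩ := hS U hU f hf
    exact ⟨C, hC, ε, hε, fun g hg => ⟨U, hU, h g hg⟩⟩

/-- The inclusion of `L^p_μ` into `L^p_{μ,loc}`. -/
def ofLp (f : Lp Y p μ) : LpLoc Y p μ :=
  ⟨f.1, fun C _ => (Lp.memLp f).restrict C⟩

variable {Y p μ}

/-- The essential support of `‖f‖`. -/
def essSupport (f : LpLoc Y p μ) : Set (Fin d → ℝ) :=
  (⋃₀ {U : Set (Fin d → ℝ) | IsOpen U ∧ ∀ᵐ x ∂μ, x ∈ U → ‖f.1 x‖ = 0})ᶜ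

variable (Y p μ)

/-- The elements of `L^p_{μ,loc}` that are essentially supported in `K 0 ∪ ⋯ ∪ K n`. -/
abbrev Composite (K : ℕ → Set (Fin d → ℝ)) (n : ℕ) : Type _ :=
  {f : LpLoc Y p μ // essSupport f ⊆ ⋃ i ∈ Finset.range (n + 1), K i}

/-- The distance on `Composite Y p μ K n` belonging to the norm
`‖f‖ = max_{i ≤ n} (∫ ‖f 1_{K i}‖^p dμ)^(1/p)`. -/
noncomputable def compositeDist (K : ℕ → Set (Fin d → ℝ)) (n : ℕ) (f g : Composite Y p μ K n) :
    ℝ≥0∞ :=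
  (Finset.range (n + 1)).sup
    fun i => eLpNorm ((K i).indicator fun x => f.1.1 x - g.1.1 x) p μ

/-- The norm topology of `Composite Y p μ K n`. -/
@[reducible] def compositeTopology (K : ℕ → Set (Fin d → ℝ)) (n : ℕ) :
    TopologicalSpace (Composite Y p μ K n) where
  IsOpen U := ∀ f ∈ U, ∃ ε : ℝ≥0∞, 0 < ε ∧ ∀ g, compositeDist Y p μ K n g f < ε → g ∈ U
  isOpen_univ := fun _ _ => ⟨1, one_pos, fun _ _ => trivial⟩
  isOpen_inter := by
    rintro U V hU hV f ⟨hfU, hfV⟩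
    obtain ⟨ε, hε, h⟩ := hU f hfU
    obtain ⟨ε', hε', h'⟩ := hV f hfV
    exact ⟨min ε ε', lt_min hε hε', fun g hg =>
      ⟨h g (hg.trans_le (min_le_left _ _)), h' g (hg.trans_le (min_le_right _ _))⟩⟩
  isOpen_sUnion := by
    rintro S hS f ⟨U, hU, hf⟩
    obtain ⟨ε, hε, h⟩ := hS U hU f hf
    exact ⟨ε, hε, fun g hg => ⟨U, hU, h g hg⟩⟩

/-- The union over `n` of the spaces `Composite Y p μ K n`. -/
abbrev CompositeUnion (K : ℕ → Set (Fin d → ℝ)) : Type _ :=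
  {f : LpLoc Y p μ // ∃ n, essSupport f ⊆ ⋃ i ∈ Finset.range (n + 1), K i}

/-- The topology `τ_∞` of `CompositeUnion Y p μ K`: the finest one for which the inclusions of
all `Composite Y p μ K n` are continuous (the direct limit topology). -/
@[reducible] def limitTopology (K : ℕ → Set (Fin d → ℝ)) : TopologicalSpace (CompositeUnion Y p μ K) :=
  ⨆ n, TopologicalSpace.coinduced
    (fun f : Composite Y p μ K n => (⟨f.1, n, f.2⟩ : CompositeUnion Y p μ K))
    (compositeTopology Y p μ K n)

/-- The strict topology: the smallest topology on `L^p_{μ,loc}` that contains the open sets of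
`CompositeUnion Y p μ K` for `τ_∞`, those of `L^p_μ` for its norm, and those of `L^p_{μ,loc}`. -/
@[reducible] def strictTopology [Fact (1 ≤ p)] (K : ℕ → Set (Fin d → ℝ)) : TopologicalSpace (LpLoc Y p μ) :=
  TopologicalSpace.generateFrom
    ({V | ∃ U : Set (CompositeUnion Y p μ K),
        IsOpen[limitTopology Y p μ K] U ∧ V = Subtype.val '' U} ∪
      {V | ∃ U : Set (Lp Y p μ), IsOpen U ∧ V = ofLp Y p μ '' U} ∪
      {V | IsOpen[locTopology Y p μ] V})

variable {Y}

/-- A class `F` of continuous functions, viewed in `L^p_{μ,loc}`. -/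
def classIn (F : Set C(Fin d → ℝ, Y)) : Set (LpLoc Y p μ) :=
  {g | ∃ f ∈ F, g.1 =ᵐ[μ] f}

/-- The architope upgrade of `F`: all classes in `L^p_{μ,loc}` of functions
`∑_{i ≤ n} β i • 1_{K i} f i + β₀ • 1_{(K 0 ∪ ⋯ ∪ K n)ᶜ} f₀` with `f₀, f i ∈ F` and real `β₀, β i`
that are not all zero. -/
def tope [NormedSpace ℝ Y] (K : ℕ → Set (Fin d → ℝ)) (F : Set C(Fin d → ℝ, Y)) :
    Set (LpLoc Y p μ) :=
  {g | ∃ (n : ℕ) (β₀ : ℝ) (β : ℕ → ℝ) (f₀ : C(Fin d → ℝ, Y)) (f : ℕ → C(Fin d → ℝ, Y)),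
      f₀ ∈ F ∧ (∀ i ∈ Finset.range (n + 1), f i ∈ F) ∧
      (β₀ ≠ 0 ∨ ∃ i ∈ Finset.range (n + 1), β i ≠ 0) ∧
      g.1 =ᵐ[μ] fun x =>
        (∑ i ∈ Finset.range (n + 1), β i • (K i).indicator (f i) x) +
          β₀ • (⋃ i ∈ Finset.range (n + 1), K i)ᶜ.indicator f₀ x}

end Spaces

end Architope

/-! Convolutional networks. A mask is a polynomial and convolution is multiplication by it. A real
polynomial splits into factors of degree at most two, so, as `s ≥ 2`, suitable depth realises
multiplication by any fixed `Q` (`exists_prod_natDegree_le_two`). On a compact set the biases can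
keep all intermediate layers positive, so that ReLU acts only at the last one (`exists_bias`).
Packing weight vectors into `Q` then turns every shallow ReLU network into a deep convolutional one
on that set (`exists_mem_Conv_eq_shallow`). Shallow networks are uniformly dense there: exponentials
of linear forms span a point-separating algebra, and each is a limit of piecewise linear ridge
functions (`dense_shallow`). Passing through bounded continuous functions gives density in `L^p_ν`.

Architopes. Each `f` is approximated independently on finitely many pieces `K i` and replaced by
zero elsewhere. One sequence serves all three ingredients of the strict topology
(`exists_tope_seq`): its pieces exhaust the space, unless `f` is supported in finitely many of them,
in which case the supports stay in a fixed finite union.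

For the failing converse, a particular-point topology distinguishes a set from any proper subset;
the indicator of `K 0` separates the two classes because it has no continuous representative when
`μ` has full support. -/

namespace Architope

/-! ### Masks as polynomials -/

open Polynomial in
/-- The mask whose entries are the coefficients of a polynomial. -/
noncomputable def polyMask (P : ℝ[X]) : ℤ → ℝ := fun k => if 0 ≤ k then P.coeff k.toNat else 0

open Polynomial in
/-- The polynomial whose coefficients are the entries of a vector. -/
noncomputable def vecPoly {m : ℕ} (v : Fin m → ℝ) : ℝ[X] := ∑ j : Fin m, monomial j (v j)

section Masks

open Polynomial

theorem coeff_mul_vecPoly {m : ℕ} (P : ℝ[X]) (v : Fin m → ℝ) (i : ℕ) :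
    (P * vecPoly v).coeff i = ∑ j : Fin m, (if (j : ℕ) ≤ i then P.coeff (i - j) else 0) * v j := by
  simp only [vecPoly, Finset.mul_sum, finsetSum_coeff]
  refine Finset.sum_congr rfl fun j _ => ?_
  rw [← C_mul_X_pow_eq_monomial, ← mul_assoc, mul_comm P, mul_assoc, coeff_C_mul, coeff_mul_X_pow',
    mul_comm]

theorem convolve_polyMask {m n : ℕ} (P : ℝ[X]) (v : Fin m → ℝ) (i : Fin n) :
    convolve (polyMask P) v i = (P * vecPoly v).coeff i := by
  rw [coeff_mul_vecPoly, convolve]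
  refine Finset.sum_congr rfl fun j _ => ?_
  simp only [polyMask, sub_nonneg, Nat.cast_le]
  split_ifs with h
  · congr 2
    omega
  · rfl

theorem natDegree_vecPoly_le {m : ℕ} (v : Fin m → ℝ) : (vecPoly v).natDegree ≤ m - 1 :=
  natDegree_sum_le_of_forall_le _ _ fun j _ =>
    (natDegree_monomial_le _).trans (Nat.le_sub_one_of_lt j.2)

theorem vecPoly_coeff {m : ℕ} (q : ℝ[X]) (hq : q.natDegree < m) :
    vecPoly (fun j : Fin m => q.coeff j) = q := by
  conv_rhs => rw [as_sum_range' q m hq]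
  exact Fin.sum_univ_eq_sum_range (fun j => monomial j (q.coeff j)) m

theorem coeff_vecPoly {m : ℕ} (v : Fin m → ℝ) (i : Fin m) : (vecPoly v).coeff i = v i := by
  simp [vecPoly, coeff_monomial, Fin.val_inj]

theorem convolve_add {m n : ℕ} (w : ℤ → ℝ) (u v : Fin m → ℝ) (i : Fin n) :
    convolve w (fun j => u j + v j) i = convolve w u i + convolve w v i := by
  simp [convolve, mul_add, Finset.sum_add_distrib]

/-- Pre-activations are bounded on a compact set, so adding a large constant makes them nonnegative
and ReLU acts as the identity. The next bias removes that constant after it has passed through the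
mask. -/
theorem exists_bias {d s : ℕ} (hd : 0 < d) (P : ℕ → ℝ[X]) (hP : ∀ j, (P j).natDegree ≤ s)
    {A : Set (Fin d → ℝ)} (hA : IsCompact A) (J : ℕ) (T : ℕ → ℝ) :
    ∃ b : (j : ℕ) → Fin (d + s * j) → ℝ, ∀ x ∈ A, ∀ i : Fin (d + s * (J + 1)),
      convLayer s (fun j => polyMask (P (j - 1))) b x (J + 1) i =
        max 0 (((∏ l ∈ Finset.range (J + 1), P l) * vecPoly x).coeff i - T i) := by
  have hbound : ∀ j, ∃ M : ℝ, ∀ x ∈ A, ∀ i : Fin (d + s * j),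
      |((∏ l ∈ Finset.range j, P l) * vecPoly x).coeff i| ≤ M := by
    intro j
    have hcont : Continuous fun (x : Fin d → ℝ) (i : Fin (d + s * j)) =>
        ((∏ l ∈ Finset.range j, P l) * vecPoly x).coeff i := by
      simp only [coeff_mul_vecPoly]
      fun_prop
    obtain ⟨M, hM⟩ := hA.exists_bound_of_continuousOn hcont.continuousOn
    exact ⟨M, fun x hx i => (norm_le_pi_norm _ i).trans (hM x hx)⟩
  choose M hM using hbound
  -- `c j` is the shift carried by layer `j`; the input layer carries none.
  let c : ℕ → ℝ := fun j => if j = 0 then 0 else M j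
  -- The convolution term cancels the previous shift; `-c j` installs the new one, except at layer
  -- `J + 1`, where the thresholds `T` enter. Layer `j` uses the factor `P (j - 1)`.
  let b : (j : ℕ) → Fin (d + s * j) → ℝ := fun j i =>
    convolve (polyMask (P (j - 1))) (fun _ : Fin (d + s * (j - 1)) => c (j - 1)) i +
      if j = J + 1 then T i else -c j
  have hdeg : ∀ j (x : Fin d → ℝ),
      ((∏ l ∈ Finset.range j, P l) * vecPoly x).natDegree < d + s * j := by
    intro j x
    have h1 : (∏ l ∈ Finset.range j, P l).natDegree ≤ s * j := by
      refine (natDegree_prod_le _ _).trans ((Finset.sum_le_sum fun l _ => hP l).trans ?_)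
      simp [mul_comm]
    have h2 := natDegree_vecPoly_le x
    have h3 := natDegree_mul_le (p := ∏ l ∈ Finset.range j, P l) (q := vecPoly x)
    omega
  have hstep : ∀ j (x : Fin d → ℝ), (∀ i : Fin (d + s * j),
      convLayer s (fun j => polyMask (P (j - 1))) b x j i =
        ((∏ l ∈ Finset.range j, P l) * vecPoly x).coeff i + c j) →
      ∀ i : Fin (d + s * (j + 1)),
        convLayer s (fun j => polyMask (P (j - 1))) b x (j + 1) i =
          max 0 (((∏ l ∈ Finset.range (j + 1), P l) * vecPoly x).coeff i -
            if j + 1 = J + 1 then T i else -c (j + 1)) := by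
    intro j x h i
    have h' := funext h
    simp only [convLayer, b, Nat.add_sub_cancel]
    rw [h', convolve_add, convolve_polyMask, vecPoly_coeff _ (hdeg j x), Finset.prod_range_succ]
    congr 1
    rw [mul_comm _ (P j), mul_assoc]
    have hcancel : ∀ u v z : ℝ, u + v - (v + z) = u - z := fun u v z => by ring
    exact hcancel _ _ _
  have hlayer : ∀ x ∈ A, ∀ j ≤ J, ∀ i : Fin (d + s * j),
      convLayer s (fun j => polyMask (P (j - 1))) b x j i =
        ((∏ l ∈ Finset.range j, P l) * vecPoly x).coeff i + c j := by
    intro x hx j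
    induction j with
    | zero =>
      intro _ i
      simp only [convLayer, Finset.range_zero, Finset.prod_empty, one_mul, c, if_true, add_zero]
      exact (coeff_vecPoly x i).symm
    | succ j ih =>
      intro hj i
      rw [hstep j x (ih (by omega)) i, if_neg (by omega), sub_neg_eq_add, max_eq_right]
      have := (abs_le.1 (hM (j + 1) x hx i)).1
      simp only [c, Nat.succ_ne_zero, if_false]
      linarith
  exact ⟨b, fun x hx i => by rw [hstep J x (hlayer x hx J le_rfl) i, if_pos rfl]⟩

/-- Irreducible real polynomials have degree at most two. Padding with factors `1` allows any larger
depth, which is needed later to make the last layer wide enough. -/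
theorem exists_prod_natDegree_le_two (Q : ℝ[X]) :
    ∃ (n : ℕ) (P : ℕ → ℝ[X]), (∀ j, (P j).natDegree ≤ 2) ∧
      ∀ j ≥ n, ∏ l ∈ Finset.range j, P l = Q := by
  have hconst : ∀ q : ℝ[X], q.natDegree ≤ 2 → ∃ (n : ℕ) (P : ℕ → ℝ[X]),
      (∀ j, (P j).natDegree ≤ 2) ∧ ∀ j ≥ n, ∏ l ∈ Finset.range j, P l = q := by
    intro q hq
    refine ⟨1, fun j => if j = 0 then q else 1, fun j => ?_, fun j hj => ?_⟩
    · by_cases h : j = 0 <;> simp [h, hq]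
    · rw [Finset.prod_ite_eq' (Finset.range j) 0 (fun _ => q)]
      simp [Nat.pos_of_ne_zero (by omega : j ≠ 0)]
  induction Q using UniqueFactorizationMonoid.induction_on_prime with
  | h₁ => exact hconst 0 (by simp)
  | h₂ x hx => exact hconst x (by simp [natDegree_eq_zero_of_isUnit hx])
  | h₃ a p ha hp ih =>
    obtain ⟨n, P, hP, hprod⟩ := ih
    refine ⟨n + 1, fun j => Nat.casesOn j p P, fun j => ?_, fun j hj => ?_⟩
    · cases j with
      | zero => exact hp.irreducible.natDegree_le_two
      | succ j => exact hP j
    · obtain ⟨k, rfl⟩ : ∃ k, j = k + 1 := ⟨j - 1, by omega⟩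
      rw [Finset.prod_range_succ', hprod k (by omega)]
      exact mul_comm _ _

end Masks

/-! ### Shallow networks inside convolutional ones -/

theorem continuous_convLayer {d : ℕ} (s : ℕ) (w : ℕ → ℤ → ℝ) (b : (j : ℕ) → Fin (d + s * j) → ℝ)
    (j : ℕ) : Continuous fun x => convLayer s w b x j := by
  induction j with
  | zero => exact continuous_id
  | succ j ih =>
    refine continuous_pi fun i => ?_
    simp only [convLayer, convolve]
    have : ∀ k, Continuous fun x => convLayer s w b x j k := fun k => (continuous_apply k).comp ih
    fun_prop

open Polynomial in
/-- On compact sets, every shallow ReLU network agrees with a deep convolutional network. -/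
theorem exists_mem_Conv_eq_shallow {d s : ℕ} (hd : 0 < d) (hs : 2 ≤ s) {A : Set (Fin d → ℝ)}
    (hA : IsCompact A) (M : ℕ) (c t : Fin M → ℝ) (a : Fin M → Fin d → ℝ) :
    ∃ f ∈ Conv d s, ∀ x ∈ A, f x = ∑ m, c m * max 0 (a m ⬝ᵥ x - t m) := by
  -- The weight vectors are stored reversed in consecutive blocks of length `d`, so that a
  -- coefficient of a product with `Q` becomes a dot product.
  let Q : ℝ[X] := ∑ n : Fin (M * d),
    monomial n (a (finProdFinEquiv.symm n).1 (finProdFinEquiv.symm n).2.rev)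
  obtain ⟨n, P, hP, hprod⟩ := exists_prod_natDegree_le_two Q
  -- The summand `n` makes the product of masks equal to `Q`; `M * d` makes the output wide enough
  -- to contain all `M` coefficients.
  let J := n + M * d
  have hQ : ∀ (m : Fin M) (k : Fin d), Q.coeff (k + d * m) = a m k.rev := by
    intro m k
    have := coeff_vecPoly
      (fun n : Fin (M * d) => a (finProdFinEquiv.symm n).1 (finProdFinEquiv.symm n).2.rev)
      (finProdFinEquiv (m, k))
    rw [Equiv.symm_apply_apply] at this
    exact this
  have hcoeff : ∀ (m : Fin M) (x : Fin d → ℝ),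
      (Q * vecPoly x).coeff (d * m + (d - 1)) = a m ⬝ᵥ x := by
    intro m x
    rw [coeff_mul_vecPoly]
    refine Finset.sum_congr rfl fun j _ => ?_
    rw [if_pos (by omega)]
    have h := hQ m j.rev
    rw [Fin.rev_rev] at h
    rw [← h, Fin.val_rev]
    congr 2
    omega
  have hlt : ∀ m : Fin M, d * m + (d - 1) < d + s * (J + 1) := by
    intro m
    have h1 : d * (m + 1) ≤ M * d := by
      rw [mul_comm M]; exact Nat.mul_le_mul_left d m.2
    have h2 : 1 * (J + 1) ≤ s * (J + 1) := Nat.mul_le_mul_right _ (by omega)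
    simp only [J, mul_add, mul_one] at *
    omega
  -- Division by `d` recovers `m` from the position `d * m + (d - 1)`; positions outside the blocks
  -- get a dummy threshold.
  obtain ⟨b, hb⟩ := exists_bias hd P (fun j => (hP j).trans hs) hA J
    fun i => if h : i / d < M then t ⟨i / d, h⟩ else 0
  let W : (Fin (d + s * (J + 1)) → ℝ) →ᵃ[ℝ] ℝ :=
    (∑ m, c m • LinearMap.proj (R := ℝ) (φ := fun _ => ℝ) ⟨_, hlt m⟩ :
      (Fin (d + s * (J + 1)) → ℝ) →ₗ[ℝ] ℝ).toAffineMap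
  refine ⟨⟨fun x => W (convLayer s (fun j => polyMask (P (j - 1))) b x (J + 1)),
    W.continuous_of_finiteDimensional.comp (continuous_convLayer s _ b (J + 1))⟩,
    ⟨J + 1, _, b, W, by omega, fun j k hk => ?_, fun x => rfl⟩, fun x hx => ?_⟩
  · have h0 : 0 ≤ k := by
      by_contra h
      simp [polyMask, h] at hk
    refine ⟨h0, ?_⟩
    simp only [polyMask, h0, if_true] at hk
    have := le_natDegree_of_ne_zero hk
    have := hP (j - 1)
    omega
  · have hdiv : ∀ m : Fin M, (d * m + (d - 1)) / d = m := fun m => by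
      rw [Nat.mul_add_div hd, Nat.div_eq_of_lt (by omega), add_zero]
    simp only [ContinuousMap.coe_mk, W, LinearMap.coe_toAffineMap, LinearMap.sum_apply,
      LinearMap.smul_apply, LinearMap.proj_apply, smul_eq_mul, hb x hx]
    refine Finset.sum_congr rfl fun m _ => ?_
    rw [hprod _ (by omega), hcoeff]
    simp [hdiv]

/-! ### Uniform density of shallow ReLU networks -/

/-- Piecewise linear interpolation at equidistant nodes, written with ReLU functions. -/
theorem abs_interpolation_sub_le (φ : ℝ → ℝ) (t₀ h ε : ℝ) (hh : 0 < h) (n : ℕ)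
    (hφ : ∀ i < n, ∀ u ∈ Set.Icc (t₀ + i * h) (t₀ + (i + 1) * h),
      |φ (t₀ + i * h) - φ u| ≤ ε ∧ |φ (t₀ + (i + 1) * h) - φ u| ≤ ε) (u : ℝ) (hu : t₀ ≤ u) :
    (u ≤ t₀ + n * h → 0 ≤ ε →
      |φ t₀ + ∑ i ∈ Finset.range n, (φ (t₀ + (i + 1) * h) - φ (t₀ + i * h)) / h *
        (max 0 (u - (t₀ + i * h)) - max 0 (u - (t₀ + (i + 1) * h))) - φ u| ≤ ε) ∧
    (t₀ + n * h ≤ u →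
      φ t₀ + ∑ i ∈ Finset.range n, (φ (t₀ + (i + 1) * h) - φ (t₀ + i * h)) / h *
        (max 0 (u - (t₀ + i * h)) - max 0 (u - (t₀ + (i + 1) * h))) = φ (t₀ + n * h)) := by
  -- The second conclusion drives the induction: past its cell each summand is constant, so the
  -- earlier terms collapse to the value at the left node of the new cell.
  induction n with
  | zero =>
    constructor
    · intro h1 h2
      have : u = t₀ := le_antisymm (by simpa using h1) hu
      simpa [this] using h2
    · simp
  | succ n ih =>
    obtain ⟨ih1, ih2⟩ := ih fun i hi => hφ i (by omega)
    rw [Finset.sum_range_succ, ← add_assoc]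
    push_cast
    constructor
    · intro h1 h2
      rcases le_total u (t₀ + n * h) with h3 | h3
      · rw [max_eq_left (by linarith), max_eq_left (by linarith)]
        simpa using ih1 h3 h2
      · rw [ih2 h3, max_eq_right (by linarith), max_eq_left (by linarith), sub_zero]
        obtain ⟨ha, hb⟩ := hφ n (by omega) u ⟨h3, h1⟩
        -- On the last cell the interpolant is the convex combination of the two node values with
        -- weights `1 - θ` and `θ`.
        set θ := (u - (t₀ + n * h)) / h
        have hθ0 : 0 ≤ θ := div_nonneg (by linarith) hh.le
        have hθ1 : θ ≤ 1 := (div_le_one hh).2 (by linarith)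
        have : φ (t₀ + n * h) + (φ (t₀ + (n + 1) * h) - φ (t₀ + n * h)) / h * (u - (t₀ + n * h)) -
            φ u = (1 - θ) * (φ (t₀ + n * h) - φ u) + θ * (φ (t₀ + (n + 1) * h) - φ u) := by
          simp only [θ]; field_simp; ring
        rw [this]
        refine (abs_add_le _ _).trans ?_
        rw [abs_mul, abs_mul, abs_of_nonneg hθ0, abs_of_nonneg (sub_nonneg.2 hθ1)]
        nlinarith
    · intro h1
      rw [ih2 (by linarith), max_eq_right (by linarith), max_eq_right (by linarith)]
      field_simp
      ring

theorem continuous_dotProduct {d : ℕ} (a : Fin d → ℝ) : Continuous fun x => a ⬝ᵥ x := by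
  unfold dotProduct
  fun_prop

/-- The restriction of the ridge function `x ↦ max 0 (a ⬝ x - t)`. -/
noncomputable def ridge {d : ℕ} (A : Set (Fin d → ℝ)) (q : (Fin d → ℝ) × ℝ) : C(A, ℝ) where
  toFun x := max 0 (q.1 ⬝ᵥ x.1 - q.2)
  continuous_toFun := continuous_const.max
    (((continuous_dotProduct q.1).comp continuous_subtype_val).sub continuous_const)

/-- The span of the ridge functions, i.e. the shallow ReLU networks. -/
noncomputable def shallow {d : ℕ} (A : Set (Fin d → ℝ)) : Submodule ℝ C(A, ℝ) :=
  Submodule.span ℝ (Set.range (ridge A))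

/-- The exponential ridge functions, as a multiplicative map. -/
noncomputable def expRidge {d : ℕ} (A : Set (Fin d → ℝ)) :
    Multiplicative (Fin d → ℝ) →* C(A, ℝ) where
  toFun a := ⟨fun x => Real.exp (a.toAdd ⬝ᵥ x.1),
    Real.continuous_exp.comp ((continuous_dotProduct a.toAdd).comp continuous_subtype_val)⟩
  map_one' := by ext x; simp
  map_mul' a b := by ext x; simp [Real.exp_add]

theorem expRidge_mem_closure {d : ℕ} {A : Set (Fin d → ℝ)} (hA : IsCompact A)
    (a : Multiplicative (Fin d → ℝ)) : expRidge A a ∈ closure (shallow A : Set C(A, ℝ)) := by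
  have : CompactSpace A := isCompact_iff_compactSpace.1 hA
  rw [Metric.mem_closure_iff]
  intro ε hε
  obtain ⟨R, hR⟩ := hA.exists_bound_of_continuousOn
    (f := fun x : Fin d → ℝ => a.toAdd ⬝ᵥ x) (continuous_dotProduct a.toAdd).continuousOn
  -- The bound `R` may be negative if `A` is empty, hence `|R|`; the extra `1` keeps the interval
  -- nondegenerate.
  have huc : UniformContinuousOn Real.exp (Set.Icc (-|R|) (|R| + 1)) :=
    isCompact_Icc.uniformContinuousOn_of_continuous Real.continuous_exp.continuousOn
  obtain ⟨δ, hδ, hφ⟩ := Metric.uniformContinuousOn_iff.1 huc (ε / 2) (half_pos hε)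
  obtain ⟨n, hn⟩ := exists_nat_gt ((2 * |R| + 1) / δ)
  have hL : 0 < 2 * |R| + 1 := by positivity
  have hn0 : (0 : ℝ) < n := lt_trans (by positivity) hn
  set h := (2 * |R| + 1) / n with hh_def
  have hh : 0 < h := by positivity
  have hhδ : h < δ := by
    rw [hh_def, div_lt_iff₀ hn0, mul_comm δ]; rwa [div_lt_iff₀ hδ] at hn
  have hnh : n * h = 2 * |R| + 1 := by rw [hh_def]; field_simp
  have key := fun u hu => abs_interpolation_sub_le Real.exp (-|R|) h (ε / 2) hh n (by
    intro i hi u hu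
    have hi' : ((i : ℝ) + 1) * h ≤ n * h := by
      gcongr; exact_mod_cast hi
    have hi0 : 0 ≤ (i : ℝ) * h := by positivity
    have h1 : (-|R| + i * h) ∈ Set.Icc (-|R|) (|R| + 1) := by
      constructor <;> linarith
    have h2 : (-|R| + (i + 1) * h) ∈ Set.Icc (-|R|) (|R| + 1) := by
      constructor <;> linarith
    have h3 : u ∈ Set.Icc (-|R|) (|R| + 1) := ⟨h1.1.trans hu.1, hu.2.trans h2.2⟩
    have hu1 := hu.1
    have hu2 := hu.2
    refine ⟨(hφ _ h1 _ h3 ?_).le, (hφ _ h2 _ h3 ?_).le⟩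
    · rw [Real.dist_eq, abs_lt]; constructor <;> linarith
    · rw [Real.dist_eq, abs_lt]; constructor <;> linarith) u hu
  -- `ridge A (0, -1)` is the constant `1`.
  let v : C(A, ℝ) := Real.exp (-|R|) • ridge A (0, -1) + ∑ i ∈ Finset.range n,
    ((Real.exp (-|R| + (i + 1) * h) - Real.exp (-|R| + i * h)) / h) •
      (ridge A (a.toAdd, -|R| + i * h) - ridge A (a.toAdd, -|R| + (i + 1) * h))
  have hmem : ∀ q, ridge A q ∈ shallow A := fun q => Submodule.subset_span ⟨q, rfl⟩
  refine ⟨v, Submodule.add_mem _ (Submodule.smul_mem _ _ (hmem _)) (Submodule.sum_mem _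
    fun i _ => Submodule.smul_mem _ _ (Submodule.sub_mem _ (hmem _) (hmem _))), ?_⟩
  refine lt_of_le_of_lt ?_ (half_lt_self hε)
  rw [dist_comm, ContinuousMap.dist_le (half_pos hε).le]
  intro x
  have hx : |a.toAdd ⬝ᵥ x.1| ≤ |R| := (hR x.1 x.2).trans (le_abs_self R)
  have := (key (a.toAdd ⬝ᵥ x.1) (abs_le.1 hx).1).1
    (by rw [hnh]; linarith [(abs_le.1 hx).2]) (half_pos hε).le
  simpa [v, ridge, expRidge, Real.dist_eq, ContinuousMap.sum_apply] using this

/-- Stone–Weierstrass for the algebra generated by the exponential ridges. They are closed under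
products, so this algebra is just their linear span, and the closure of the shallow networks
contains it. -/
theorem dense_shallow {d : ℕ} {A : Set (Fin d → ℝ)} (hA : IsCompact A) :
    Dense (shallow A : Set C(A, ℝ)) := by
  have : CompactSpace A := isCompact_iff_compactSpace.1 hA
  set B : Subalgebra ℝ C(A, ℝ) := Algebra.adjoin ℝ (Set.range (expRidge A)) with hB
  have hsep : B.SeparatesPoints := by
    intro x y hxy
    obtain ⟨i, hi⟩ : ∃ i, x.1 i ≠ y.1 i := by
      by_contra! h
      exact hxy (Subtype.ext (funext h))
    refine ⟨_, ⟨expRidge A (Multiplicative.ofAdd (Pi.single i 1)),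
      Algebra.subset_adjoin ⟨_, rfl⟩, rfl⟩, ?_⟩
    simpa [expRidge] using hi
  have htop := ContinuousMap.subalgebra_topologicalClosure_eq_top_of_separatesPoints B hsep
  have hle : Subalgebra.toSubmodule B ≤ (shallow A).topologicalClosure := by
    rw [hB, Algebra.adjoin_eq_span, Submodule.span_le]
    intro f hf
    have : Submonoid.closure (Set.range (expRidge A)) ≤ MonoidHom.mrange (expRidge A) :=
      Submonoid.closure_le.2 fun _ h => h
    obtain ⟨a, rfl⟩ := this hf
    exact expRidge_mem_closure hA a
  intro f
  have hf : f ∈ closure (B : Set C(A, ℝ)) := by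
    rw [← Subalgebra.topologicalClosure_coe, htop]; trivial
  exact closure_minimal (fun g hg => hle hg) isClosed_closure hf

/-! ### Universal approximation by convolutional networks -/

theorem exists_mem_Conv_dist_le {d s : ℕ} (hd : 0 < d) (hs : 2 ≤ s) {A : Set (Fin d → ℝ)}
    (hA : IsCompact A) (g : C(A, ℝ)) {ε : ℝ} (hε : 0 < ε) :
    ∃ f ∈ Conv d s, ∀ x : A, |g x - f x| ≤ ε := by
  have : CompactSpace A := isCompact_iff_compactSpace.1 hA
  obtain ⟨v, hv, hgv⟩ := Metric.mem_closure_iff.1 (dense_shallow hA g) ε hε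
  obtain ⟨M, c, r, rfl⟩ := Submodule.mem_span_set'.1 hv
  choose q hq using fun m => (r m).2
  obtain ⟨f, hf, hfA⟩ := exists_mem_Conv_eq_shallow hd hs hA M c (fun m => (q m).2)
    fun m => (q m).1
  refine ⟨f, hf, fun x => ?_⟩
  have := (ContinuousMap.dist_lt_iff hε).1 hgv x
  rw [hfA x.1 x.2]
  rw [Real.dist_eq] at this
  refine le_of_eq_of_le ?_ this.le
  simp [ContinuousMap.sum_apply, ← hq, ridge]

/-- The universal approximation property: convolutional networks are dense in `L^p_ν`. -/
theorem exists_mem_Conv_eLpNorm_sub_le {d s : ℕ} (hd : 0 < d) (hs : 2 ≤ s) {p : ℝ≥0∞}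
    (hp : p ≠ ∞) (hp1 : 1 ≤ p) (ν : Measure (Fin d → ℝ)) [IsFiniteMeasure ν]
    {A : Set (Fin d → ℝ)} (hA : IsCompact A) (hνA : ν Aᶜ = 0) {f : (Fin d → ℝ) → ℝ}
    (hf : MemLp f p ν) {ε : ℝ≥0∞} (hε : ε ≠ 0) :
    ∃ g ∈ Conv d s, MemLp g p ν ∧ eLpNorm (f - ⇑g) p ν ≤ ε := by
  have hA_ae : ∀ᵐ x ∂ν, x ∈ A := hνA
  obtain ⟨g, hfg, hg⟩ := hf.exists_boundedContinuous_eLpNorm_sub_le hp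
    (ENNReal.half_pos hε).ne'
  obtain ⟨η, hη, hηε⟩ : ∃ η : ℝ, 0 < η ∧
      ν Set.univ ^ p.toReal⁻¹ * ENNReal.ofReal η ≤ ε / 2 := by
    have hfin : ν Set.univ ^ p.toReal⁻¹ ≠ ∞ :=
      ENNReal.rpow_ne_top_of_nonneg (by positivity) (measure_ne_top _ _)
    have hlim : Filter.Tendsto (fun η : ℝ => ν Set.univ ^ p.toReal⁻¹ * ENNReal.ofReal η)
        (𝓝[>] 0) (𝓝 0) := by
      have h : Filter.Tendsto (fun η : ℝ => ENNReal.ofReal η) (𝓝[>] 0) (𝓝 0) := by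
        simpa using (ENNReal.continuous_ofReal.tendsto 0).mono_left nhdsWithin_le_nhds
      simpa using ENNReal.Tendsto.const_mul h (Or.inr hfin)
    obtain ⟨η, h1, h2⟩ := ((hlim.eventually_lt_const (ENNReal.half_pos hε)).and
      self_mem_nhdsWithin).exists
    exact ⟨η, h2, h1.le⟩
  obtain ⟨f', hf', hgf'⟩ := exists_mem_Conv_dist_le (s := s) hd hs hA
    (g.toContinuousMap.restrict A) hη
  have hbd : ∀ᵐ x ∂ν, ‖(⇑g - ⇑f') x‖ ≤ η := hA_ae.mono fun x hx => hgf' ⟨x, hx⟩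
  have hmeas : AEStronglyMeasurable (⇑g - ⇑f') ν :=
    (g.continuous.sub f'.continuous).aestronglyMeasurable
  have hmem : MemLp (⇑g - ⇑f') p ν := MemLp.of_bound hmeas η hbd
  refine ⟨f', hf', by simpa using hg.sub hmem, ?_⟩
  calc eLpNorm (f - ⇑f') p ν = eLpNorm ((f - ⇑g) + (⇑g - ⇑f')) p ν := by congr 1; abel
    _ ≤ eLpNorm (f - ⇑g) p ν + eLpNorm (⇑g - ⇑f') p ν :=
        eLpNorm_add_le (hf.1.sub hg.1) hmeas hp1
    _ ≤ ε / 2 + ε / 2 := add_le_add hfg ((eLpNorm_le_of_ae_bound hbd).trans hηε)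
    _ = ε := ENNReal.add_halves ε

theorem dense_Conv_Lp {d s : ℕ} (hd : 0 < d) (hs : 2 ≤ s) {p : ℝ≥0∞} [Fact (1 ≤ p)]
    (hp : p ≠ ∞) (ν : Measure (Fin d → ℝ)) [IsFiniteMeasure ν]
    {A : Set (Fin d → ℝ)} (hA : IsCompact A) (hνA : ν Aᶜ = 0) :
    Dense {g : Lp ℝ p ν | ∃ f ∈ Conv d s, g =ᵐ[ν] f} := by
  intro f
  rw [Metric.mem_closure_iff]
  intro ε hε
  obtain ⟨g, hg, hgm, hfg⟩ := exists_mem_Conv_eLpNorm_sub_le hd hs hp Fact.out ν hA hνA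
    (Lp.memLp f) (ε := ENNReal.ofReal (ε / 2)) (by simpa using hε)
  refine ⟨hgm.toLp g, ⟨g, hg, hgm.coeFn_toLp⟩, ?_⟩
  rw [Lp.dist_def, eLpNorm_congr_ae ((Filter.EventuallyEq.refl _ _).sub hgm.coeFn_toLp)]
  refine lt_of_le_of_lt (ENNReal.toReal_mono ENNReal.ofReal_ne_top hfg) ?_
  rw [ENNReal.toReal_ofReal (half_pos hε).le]
  exact half_lt_self hε

/-! ### Essential supports, partitions and tails -/

open Filter

section EssSupport

variable {d : ℕ} {Y : Type*} [NormedAddCommGroup Y] {p : ℝ≥0∞} {μ : Measure (Fin d → ℝ)}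

theorem essSupport_subset {f : LpLoc Y p μ} {S : Set (Fin d → ℝ)} (hS : IsClosed S)
    (hf : ∀ᵐ x ∂μ, x ∉ S → f.1 x = 0) : essSupport f ⊆ S :=
  Set.compl_subset_comm.1 <| Set.subset_sUnion_of_mem
    ⟨hS.isOpen_compl, hf.mono fun _ hx hxS => by rw [hx hxS, norm_zero]⟩

/-- By the Lindelöf property, countably many of the open sets defining the essential support
suffice, so their exceptional null sets can be united. -/
theorem ae_eq_zero_of_essSupport_subset {f : LpLoc Y p μ} {S : Set (Fin d → ℝ)}
    (hf : essSupport f ⊆ S) : ∀ᵐ x ∂μ, x ∉ S → f.1 x = 0 := by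
  obtain ⟨T, hTc, hTsub, hT⟩ := TopologicalSpace.isOpen_sUnion_countable
    {U : Set (Fin d → ℝ) | IsOpen U ∧ ∀ᵐ x ∂μ, x ∈ U → ‖f.1 x‖ = 0} fun U hU => hU.1
  have h : ∀ᵐ x ∂μ, ∀ U ∈ T, x ∈ U → ‖f.1 x‖ = 0 :=
    (ae_ball_iff hTc).2 fun U hU => (hTsub hU).2
  filter_upwards [h] with x hx hxS
  have hxT : x ∈ ⋃₀ T := by
    rw [hT]
    by_contra hn
    exact hxS (hf hn)
  obtain ⟨U, hU, hxU⟩ := hxT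
  exact norm_eq_zero.1 (hx U hU hxU)

end EssSupport

theorem isCompact_biUnion_partition {d : ℕ} {μ : Measure (Fin d → ℝ)} {K : ℕ → Set (Fin d → ℝ)}
    (hK : IsPartition μ K) (n : ℕ) : IsCompact (⋃ i ∈ Finset.range (n + 1), K i) :=
  (Finset.range (n + 1)).isCompact_biUnion fun i _ => hK.isCompact i

theorem ae_disjoint {d : ℕ} {μ : Measure (Fin d → ℝ)} {K : ℕ → Set (Fin d → ℝ)}
    (hK : IsPartition μ K) : ∀ᵐ x ∂μ, ∀ i j, i ≠ j → x ∈ K i → x ∉ K j := by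
  simp only [ae_all_iff]
  intro i j hij
  rw [ae_iff]
  convert hK.inter i j hij using 2
  ext x
  simp

/-- Continuity from above of the finite measure with density `‖f‖ ^ p`, along complements decreasing
to a null set. -/
theorem tendsto_eLpNorm_restrict_compl {d : ℕ} {p : ℝ≥0∞} (hp0 : p ≠ 0) (hp : p ≠ ∞)
    {ν : Measure (Fin d → ℝ)} {K : ℕ → Set (Fin d → ℝ)} (hKm : ∀ n, MeasurableSet (K n))
    (hcover : ν (⋃ n, K n)ᶜ = 0) {f : (Fin d → ℝ) → ℝ} (hf : MemLp f p ν) :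
    Tendsto (fun n => eLpNorm f p (ν.restrict (⋃ i ∈ Finset.range (n + 1), K i)ᶜ)) atTop (𝓝 0) := by
  set S : ℕ → Set (Fin d → ℝ) := fun n => (⋃ i ∈ Finset.range (n + 1), K i)ᶜ with hS
  have hSm : ∀ n, MeasurableSet (S n) := fun n =>
    ((Finset.range (n + 1)).measurableSet_biUnion fun i _ => hKm i).compl
  set ρ := ν.withDensity fun x => ‖f x‖ₑ ^ p.toReal with hρ
  have hfin : ρ Set.univ ≠ ∞ := by
    rw [hρ, withDensity_apply _ MeasurableSet.univ, Measure.restrict_univ]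
    exact ((eLpNorm_lt_top_iff_lintegral_rpow_enorm_lt_top hp0 hp).1 hf.2).ne
  have hanti : Antitone S := by
    intro m n hmn
    refine Set.compl_subset_compl.2 (Set.biUnion_subset_biUnion_left fun i hi => ?_)
    simp only [SetLike.mem_coe, Finset.mem_range] at hi ⊢
    omega
  have hzero : ρ (⋂ n, S n) = 0 := by
    refine withDensity_absolutelyContinuous _ _ (measure_mono_null (fun x hx => ?_) hcover)
    simp only [hS, Set.mem_iInter, Set.mem_compl_iff, Set.mem_iUnion, not_exists,
      Finset.mem_range] at hx ⊢
    exact fun n => hx n n (by omega)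
  have hlim := tendsto_measure_iInter_atTop (μ := ρ) (fun n => (hSm n).nullMeasurableSet) hanti
    ⟨0, measure_ne_top_of_subset (Set.subset_univ _) hfin⟩
  rw [hzero] at hlim
  have hpos : 0 < 1 / p.toReal := by
    have := ENNReal.toReal_pos hp0 hp
    positivity
  have := (ENNReal.continuous_rpow_const (y := 1 / p.toReal)).tendsto 0 |>.comp hlim
  rw [ENNReal.zero_rpow_of_pos hpos] at this
  refine this.congr fun n => ?_
  rw [eLpNorm_eq_lintegral_rpow_enorm_toReal hp0 hp, Function.comp_apply,
    Function.comp_apply, hρ, withDensity_apply _ (hSm n)]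

/-! ### Density of architopes -/

section Tope

variable {d s : ℕ} {p : ℝ≥0∞} {μ : Measure (Fin d → ℝ)} {K : ℕ → Set (Fin d → ℝ)}

/-- Universal approximation applies to each finite measure `μ.restrict (K i)`; since the pieces
overlap in null sets, the glued summands do not interfere. Taking `β₀ = 0` kills the tail. -/
theorem exists_mem_tope_approx (hd : 0 < d) (hs : 2 ≤ s) (hp : p ≠ ∞) (hp1 : 1 ≤ p)
    (hK : IsPartition μ K) (hKμ : ∀ n, μ (K n) < ∞) (f : LpLoc ℝ p μ) (n : ℕ) {ε : ℝ≥0∞}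
    (hε : ε ≠ 0) :
    ∃ g ∈ tope p μ K (Conv d s), MemLp g.1 p μ ∧
      (∀ᵐ x ∂μ, x ∉ ⋃ i ∈ Finset.range (n + 1), K i → g.1 x = 0) ∧
      ∀ i ∈ Finset.range (n + 1), eLpNorm (fun x => g.1 x - f.1 x) p (μ.restrict (K i)) ≤ ε := by
  have hKm : ∀ i, MeasurableSet (K i) := fun i => (hK.isCompact i).measurableSet
  have happrox : ∀ i, ∃ h ∈ Conv d s, MemLp h p (μ.restrict (K i)) ∧
      eLpNorm (⇑f.1 - ⇑h) p (μ.restrict (K i)) ≤ ε := by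
    intro i
    have : IsFiniteMeasure (μ.restrict (K i)) := ⟨by simpa using hKμ i⟩
    refine exists_mem_Conv_eLpNorm_sub_le hd hs hp hp1 _ (hK.isCompact i) ?_
      (f.2 _ (hK.isCompact i)) hε
    rw [Measure.restrict_apply (hKm i).compl, Set.compl_inter_self, measure_empty]
  choose h hhC hhm hhε using happrox
  set G : (Fin d → ℝ) → ℝ := fun x => ∑ i ∈ Finset.range (n + 1), (K i).indicator (h i) x with hG
  have hGm : MemLp G p μ :=
    memLp_finsetSum _ fun i _ => (memLp_indicator_iff_restrict (hKm i)).2 (hhm i)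
  let g : LpLoc ℝ p μ := ⟨AEEqFun.mk G hGm.1, fun C _ =>
    ((memLp_congr_ae (AEEqFun.coeFn_mk G hGm.1)).2 hGm).restrict C⟩
  have hg : g.1 =ᵐ[μ] G := AEEqFun.coeFn_mk G hGm.1
  refine ⟨g, ⟨n, 0, fun _ => 1, h 0, h, hhC 0, fun i _ => hhC i, Or.inr ⟨0, by simp⟩, ?_⟩,
    (memLp_congr_ae hg).2 hGm, ?_, fun i hi => ?_⟩
  · filter_upwards [hg] with x hx
    simp [hx, hG]
  · filter_upwards [hg] with x hx hxU
    rw [hx]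
    refine Finset.sum_eq_zero fun i hi => Set.indicator_of_notMem (fun hxi => hxU ?_) _
    exact Set.mem_biUnion hi hxi
  · refine le_trans (le_of_eq ?_) (hhε i)
    rw [← eLpNorm_neg]
    refine eLpNorm_congr_ae ?_
    filter_upwards [ae_restrict_of_ae hg, ae_restrict_of_ae (ae_disjoint hK),
      ae_restrict_mem (hKm i)] with x hx hdis hxi
    have : G x = h i x := by
      rw [hG]
      refine (Finset.sum_eq_single_of_mem i hi fun j _ hj => ?_).trans
        (Set.indicator_of_mem hxi _)
      exact Set.indicator_of_notMem (hdis i j hj.symm hxi) _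
    simp [hx, this]

/-- Outside the pieces the error is `f` itself; on them it is dominated by the sum of its
restrictions, overlaps only enlarging the bound. -/
theorem eLpNorm_sub_le_sum (hp1 : 1 ≤ p) (hK : IsPartition μ K) (f g : (Fin d → ℝ) →ₘ[μ] ℝ) (n : ℕ)
    (hg : ∀ᵐ x ∂μ, x ∉ ⋃ i ∈ Finset.range (n + 1), K i → g x = 0) {ν : Measure (Fin d → ℝ)}
    (hν : ν ≤ μ) :
    eLpNorm (fun x => g x - f x) p ν ≤
      ∑ i ∈ Finset.range (n + 1), eLpNorm (fun x => g x - f x) p (μ.restrict (K i)) +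
        eLpNorm f p (ν.restrict (⋃ i ∈ Finset.range (n + 1), K i)ᶜ) := by
  have hKm : ∀ i, MeasurableSet (K i) := fun i => (hK.isCompact i).measurableSet
  set U := ⋃ i ∈ Finset.range (n + 1), K i with hU
  have hUm : MeasurableSet U := (Finset.range (n + 1)).measurableSet_biUnion fun i _ => hKm i
  have hf : AEStronglyMeasurable f ν := f.aestronglyMeasurable.mono_measure hν
  have hgm : AEStronglyMeasurable g ν := g.aestronglyMeasurable.mono_measure hν
  have hD : AEStronglyMeasurable (fun x => ‖g x - f x‖) ν := (hgm.sub hf).norm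
  let F : (Fin d → ℝ) → ℝ :=
    ∑ i ∈ Finset.range (n + 1), (K i).indicator (fun x => ‖g x - f x‖)
  let F' : (Fin d → ℝ) → ℝ := Uᶜ.indicator fun x => ‖f x‖
  have hle : ∀ᵐ x ∂ν, ‖g x - f x‖ ≤ ‖(F + F') x‖ := by
    filter_upwards [Measure.ae_le_iff_absolutelyContinuous.2
      (Measure.absolutelyContinuous_of_le hν) hg] with x hx
    refine le_trans ?_ (le_abs_self _)
    have hnn : ∀ i ∈ Finset.range (n + 1),
        0 ≤ (K i).indicator (fun x => ‖g x - f x‖) x := fun i _ =>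
      Set.indicator_nonneg (fun _ _ => norm_nonneg _) _
    by_cases hxU : x ∈ U
    · obtain ⟨i, hi, hxi⟩ := Set.mem_iUnion₂.1 hxU
      have h1 := Finset.single_le_sum hnn hi
      rw [Set.indicator_of_mem hxi] at h1
      simpa [F, F', hxU, Finset.sum_apply] using h1
    · have h1 := Finset.sum_nonneg hnn
      simpa [F, F', hxU, Finset.sum_apply, hx hxU] using h1
  refine (eLpNorm_mono_ae hle).trans ((eLpNorm_add_le
    (Finset.aestronglyMeasurable_sum _ fun i _ => hD.indicator (hKm i))
    (hf.norm.indicator hUm.compl) hp1).trans ?_)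
  refine add_le_add ((eLpNorm_sum_le (fun i _ => hD.indicator (hKm i)) hp1).trans
    (Finset.sum_le_sum fun i _ => ?_)) ?_
  · rw [eLpNorm_indicator_eq_eLpNorm_restrict (hKm i), eLpNorm_norm]
    exact eLpNorm_mono_measure _ (Measure.restrict_mono_measure hν _)
  · rw [eLpNorm_indicator_eq_eLpNorm_restrict hUm.compl, eLpNorm_norm]

/-- The measure `ν` covers several modes of convergence at once: `ν = μ` gives the `L^p_μ` norm, and
restrictions of `μ` to compact sets give the local and composite ones. -/
theorem exists_tope_seq (hd : 0 < d) (hs : 2 ≤ s) (hp : p ≠ ∞) (hp1 : 1 ≤ p)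
    (hK : IsPartition μ K) (hKμ : ∀ n, μ (K n) < ∞) (f : LpLoc ℝ p μ) :
    ∃ g : ℕ → LpLoc ℝ p μ, (∀ n, g n ∈ tope p μ K (Conv d s)) ∧ (∀ n, MemLp (g n).1 p μ) ∧
      (∀ ν ≤ μ, MemLp f.1 p ν →
        Tendsto (fun n => eLpNorm (fun x => (g n).1 x - f.1 x) p ν) atTop (𝓝 0)) ∧
      ((∃ n, essSupport f ⊆ ⋃ i ∈ Finset.range (n + 1), K i) →
        ∃ m, essSupport f ⊆ ⋃ i ∈ Finset.range (m + 1), K i ∧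
          ∀ n, essSupport (g n) ⊆ ⋃ i ∈ Finset.range (m + 1), K i) := by
  have hp0 : p ≠ 0 := (zero_lt_one.trans_le hp1).ne'
  have hKm : ∀ i, MeasurableSet (K i) := fun i => (hK.isCompact i).measurableSet
  -- `m n` is the last piece used by the `n`-th approximant: constant if `f` is composite, otherwise
  -- `n`.
  obtain ⟨m, hm, htail⟩ : ∃ m : ℕ → ℕ,
      ((∃ n, essSupport f ⊆ ⋃ i ∈ Finset.range (n + 1), K i) → ∃ k, (∀ n, m n = k) ∧
        essSupport f ⊆ ⋃ i ∈ Finset.range (k + 1), K i) ∧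
      ∀ ν ≤ μ, MemLp f.1 p ν → Tendsto (fun n =>
        eLpNorm f.1 p (ν.restrict (⋃ i ∈ Finset.range (m n + 1), K i)ᶜ)) atTop (𝓝 0) := by
    by_cases h : ∃ n, essSupport f ⊆ ⋃ i ∈ Finset.range (n + 1), K i
    · obtain ⟨k, hk⟩ := h
      refine ⟨fun _ => k, fun _ => ⟨k, fun _ => rfl, hk⟩, fun ν hν _ => ?_⟩
      have hzero : eLpNorm f.1 p (ν.restrict (⋃ i ∈ Finset.range (k + 1), K i)ᶜ) = 0 := by
        rw [← eLpNorm_zero (p := p)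
          (μ := ν.restrict (⋃ i ∈ Finset.range (k + 1), K i)ᶜ) (ε := ℝ)]
        refine eLpNorm_congr_ae ?_
        filter_upwards [ae_restrict_mem
          (isCompact_biUnion_partition hK k).measurableSet.compl, ae_restrict_of_ae
          (Measure.ae_le_iff_absolutelyContinuous.2 (Measure.absolutelyContinuous_of_le hν)
            (ae_eq_zero_of_essSupport_subset hk))] with x hx hx'
        exact hx' hx
      simp only [hzero]
      exact tendsto_const_nhds
    · exact ⟨id, fun h' => absurd h' h, fun ν hν hf =>
        tendsto_eLpNorm_restrict_compl hp0 hp hKm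
          (Measure.absolutelyContinuous_of_le hν hK.cover) hf⟩
  -- The tolerance makes the errors on the `m n + 1` pieces add up to at most `1 / (n + 1)`.
  choose g hgt hgm hgz hgε using fun n => exists_mem_tope_approx hd hs hp hp1 hK hKμ f (m n)
    (ε := ENNReal.ofReal (1 / ((m n + 1 : ℕ) * (n + 1)))) (by
      rw [Ne, ENNReal.ofReal_eq_zero, not_le]; positivity)
  refine ⟨g, hgt, hgm, fun ν hν hf => ?_, fun h => ?_⟩
  · have hlim : Tendsto (fun n : ℕ => ENNReal.ofReal (1 / ((n : ℝ) + 1)) +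
        eLpNorm f.1 p (ν.restrict (⋃ i ∈ Finset.range (m n + 1), K i)ᶜ)) atTop (𝓝 0) := by
      have h1 := ENNReal.tendsto_ofReal (tendsto_one_div_add_atTop_nhds_zero_nat (𝕜 := ℝ))
      rw [ENNReal.ofReal_zero] at h1
      simpa using h1.add (htail ν hν hf)
    refine tendsto_of_tendsto_of_tendsto_of_le_of_le tendsto_const_nhds hlim
      (fun _ => zero_le) fun n => ?_
    refine (eLpNorm_sub_le_sum hp1 hK f.1 (g n).1 (m n) (hgz n) hν).trans
      (add_le_add ((Finset.sum_le_sum (hgε n)).trans ?_) le_rfl)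
    rw [Finset.sum_const, Finset.card_range, nsmul_eq_mul,
      ← ENNReal.ofReal_natCast, ← ENNReal.ofReal_mul (by positivity)]
    refine ENNReal.ofReal_le_ofReal (le_of_eq ?_)
    have : ((m n + 1 : ℕ) : ℝ) ≠ 0 := by positivity
    field_simp
  · obtain ⟨k, hk, hfk⟩ := hm h
    refine ⟨k, hfk, fun n => ?_⟩
    rw [← hk n]
    exact essSupport_subset (isCompact_biUnion_partition hK _).isClosed (hgz n)

/-- It suffices that one sequence eventually enters every subbasic neighbourhood of `f`.
Neighbourhoods of the first two kinds occur only when `f` is composite or in `L^p_μ`, and then the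
sequence lies in the same space. -/
theorem dense_tope_strict [Fact (1 ≤ p)] (hd : 0 < d) (hs : 2 ≤ s) (hp : p ≠ ∞)
    (hK : IsPartition μ K) (hKμ : ∀ n, μ (K n) < ∞) :
    @Dense _ (strictTopology ℝ p μ K) (tope p μ K (Conv d s)) := by
  intro f
  obtain ⟨g, hgt, hgm, hlim, hcomp⟩ := exists_tope_seq hd hs hp Fact.out hK hKμ f
  have hKm : ∀ i, MeasurableSet (K i) := fun i => (hK.isCompact i).measurableSet
  let τ := strictTopology ℝ p μ K
  refine mem_closure_of_tendsto (b := atTop) ?_ (Eventually.of_forall hgt)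
  rw [TopologicalSpace.tendsto_nhds_generateFrom_iff]
  rintro V ((⟨U, hU, rfl⟩ | ⟨U, hU, rfl⟩) | hV) hfV
  · obtain ⟨f', hfU, rfl⟩ := hfV
    obtain ⟨m, hfm, hgm'⟩ := hcomp f'.2
    -- An open set of the direct limit is open at every level; level `m` alone suffices, as it
    -- contains `f` and the whole sequence.
    rw [isOpen_iSup_iff] at hU
    obtain ⟨ε, hε, hball⟩ := isOpen_coinduced.1 (hU m) ⟨f'.1, hfm⟩ hfU
    have hev : ∀ᶠ n in atTop, ∀ i ∈ Finset.range (m + 1),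
        eLpNorm (fun x => (g n).1 x - f'.1.1 x) p (μ.restrict (K i)) < ε := by
      rw [eventually_all_finset]
      exact fun i _ => (hlim _ Measure.restrict_le_self
        (f'.1.2 _ (hK.isCompact i))).eventually_lt_const hε
    filter_upwards [hev] with n hn
    refine ⟨⟨g n, m, hgm' n⟩, hball ⟨g n, hgm' n⟩ ?_, rfl⟩
    refine (Finset.sup_lt_iff hε).2 fun i hi => ?_
    rw [eLpNorm_indicator_eq_eLpNorm_restrict (hKm i)]
    exact hn i hi
  · obtain ⟨f', hfU, rfl⟩ := hfV
    have hev : Tendsto (fun n => (⟨(g n).1, Lp.mem_Lp_iff_memLp.2 (hgm n)⟩ : Lp ℝ p μ)) atTop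
        (𝓝 f') :=
      (Lp.tendsto_Lp_iff_tendsto_eLpNorm' _ _).2 (hlim μ le_rfl (Lp.memLp f'))
    filter_upwards [hev (hU.mem_nhds hfU)] with n hn
    exact ⟨_, hn, rfl⟩
  · obtain ⟨C, hC, ε, hε, hball⟩ := hV f hfV
    filter_upwards [(hlim _ Measure.restrict_le_self (f.2 C hC)).eventually_lt_const hε] with n hn
    exact hball _ hn

theorem exists_mem_tope_lintegral_lt (hd : 0 < d) (hs : 2 ≤ s) (hp : p ≠ ∞) (hp1 : 1 ≤ p)
    (hK : IsPartition μ K) (hKμ : ∀ n, μ (K n) < ∞) {f : (Fin d → ℝ) → ℝ} (hf : MemLp f p μ)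
    {δ : ℝ} (hδ : 0 < δ) :
    ∃ g ∈ tope p μ K (Conv d s), ∫⁻ x, ‖f x - g.1 x‖ₑ ^ p.toReal ∂μ < ENNReal.ofReal δ := by
  have hp0 : p ≠ 0 := (zero_lt_one.trans_le hp1).ne'
  have hpr : 0 < p.toReal := ENNReal.toReal_pos hp0 hp
  let f' : LpLoc ℝ p μ := ⟨AEEqFun.mk f hf.1, fun C _ =>
    ((memLp_congr_ae (AEEqFun.coeFn_mk f hf.1)).2 hf).restrict C⟩
  have hff' : f'.1 =ᵐ[μ] f := AEEqFun.coeFn_mk f hf.1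
  obtain ⟨g, hgt, -, hlim, -⟩ := exists_tope_seq hd hs hp hp1 hK hKμ f'
  have hlim' := (ENNReal.continuous_rpow_const (y := p.toReal)).tendsto 0 |>.comp
    (hlim μ le_rfl ((memLp_congr_ae hff').2 hf))
  rw [ENNReal.zero_rpow_of_pos hpr] at hlim'
  obtain ⟨n, hn⟩ := (hlim'.eventually_lt_const (ENNReal.ofReal_pos.2 hδ)).exists
  refine ⟨g n, hgt n, lt_of_eq_of_lt ?_ hn⟩
  rw [Function.comp_apply, eLpNorm_eq_lintegral_rpow_enorm_toReal hp0 hp, one_div,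
    ENNReal.rpow_inv_rpow hpr.ne']
  refine lintegral_congr_ae ?_
  filter_upwards [hff'] with x hx
  rw [hx, ← enorm_neg, neg_sub]

theorem classIn_subset_tope (F : Set C(Fin d → ℝ, ℝ)) :
    classIn p μ F ⊆ tope p μ K F := by
  rintro g ⟨f, hf, hgf⟩
  refine ⟨0, 1, fun _ => 1, f, fun _ => f, hf, fun _ _ => hf, Or.inl one_ne_zero, ?_⟩
  filter_upwards [hgf] with x hx
  by_cases h : x ∈ K 0 <;> simp [hx, h]

theorem one_mem_Conv (d s : ℕ) : (1 : C(Fin d → ℝ, ℝ)) ∈ Conv d s :=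
  ⟨1, fun _ _ => 0, fun _ _ => 0, AffineMap.const ℝ _ 1, le_rfl, fun _ _ h => absurd rfl h,
    fun _ => rfl⟩

/-- A continuous representative of the indicator of `K 0` would be idempotent everywhere by full
support, so its zero set would be clopen. By connectedness either `K 0` is conull, hence the whole
noncompact space, or it is null. -/
theorem classIn_ne_tope (hd : 0 < d) (hK : IsPartition μ K)
    (hKμ : ∀ n, 0 < μ (K n) ∧ μ (K n) < ∞) [μ.IsOpenPosMeasure] {F : Set C(Fin d → ℝ, ℝ)}
    (hF : 1 ∈ F) : classIn p μ F ≠ tope p μ K F := by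
  intro heq
  have hKm : MeasurableSet (K 0) := (hK.isCompact 0).measurableSet
  have hG : MemLp ((K 0).indicator fun _ => (1 : ℝ)) p μ :=
    memLp_indicator_const p hKm 1 (Or.inr (hKμ 0).2.ne)
  let g : LpLoc ℝ p μ := ⟨AEEqFun.mk _ hG.1, fun C _ =>
    ((memLp_congr_ae (AEEqFun.coeFn_mk _ hG.1)).2 hG).restrict C⟩
  have hg : g.1 =ᵐ[μ] (K 0).indicator fun _ => (1 : ℝ) := AEEqFun.coeFn_mk _ hG.1
  have hgt : g ∈ tope p μ K F := by
    refine ⟨0, 0, fun _ => 1, 1, fun _ => 1, hF, fun _ _ => hF, Or.inr ⟨0, by simp⟩, ?_⟩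
    filter_upwards [hg] with x hx
    by_cases h : x ∈ K 0 <;> simp [hx, h]
  rw [← heq] at hgt
  obtain ⟨f, -, hgf⟩ := hgt
  have hf : f =ᵐ[μ] (K 0).indicator fun _ => (1 : ℝ) := hgf.symm.trans hg
  have hsq : (fun x => f x * f x) = f := by
    refine (Continuous.ae_eq_iff_eq μ (f.continuous.mul f.continuous) f.continuous).1 ?_
    filter_upwards [hf] with x hx
    by_cases h : x ∈ K 0 <;> simp [hx, h]
  have hclopen : IsClopen {x | f x = 0} := by
    refine ⟨isClosed_eq f.continuous continuous_const, ?_⟩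
    have : {x | f x = 0} = {x | f x ≠ 1} := by
      ext x
      have h : f x * f x = f x := congrFun hsq x
      have h' : f x * (f x - 1) = 0 := by linarith
      rcases mul_eq_zero.1 h' with h0 | h1
      · simp [h0]
      · simp [sub_eq_zero.1 h1]
    rw [this]
    exact isOpen_ne_fun f.continuous continuous_const
  have : Nonempty (Fin d) := ⟨⟨0, hd⟩⟩
  rcases isClopen_iff.1 hclopen with h0 | h1
  · have hnull : μ (K 0)ᶜ = 0 := by
      refine measure_mono_null (fun x hx => ?_) (ae_iff.1 hf)
      intro h
      rw [Set.indicator_of_notMem hx] at h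
      have : x ∈ {x | f x = 0} := h
      rw [h0] at this
      exact this
    have hempty := ((hK.isCompact 0).isClosed.isOpen_compl.measure_eq_zero_iff μ).1 hnull
    exact (hK.isCompact 0).ne_univ (Set.compl_empty_iff.1 hempty)
  · refine (hKμ 0).1.ne' (measure_mono_null (fun x hx => ?_) (ae_iff.1 hf))
    intro h
    rw [Set.indicator_of_mem hx] at h
    have : x ∈ {x | f x = 0} := by rw [h1]; trivial
    exact zero_ne_one (Eq.trans (Eq.symm this) h)

end Tope

/-- A proper subset of a set is not dense for some topology for which the larger set is dense. -/
theorem exists_topology_dense_not_dense {α : Type*} {S T : Set α} (hST : S ⊆ T) (hne : S ≠ T) :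
    ∃ τ : TopologicalSpace α, @Dense _ τ T ∧ ¬ @Dense _ τ S := by
  obtain ⟨h, hT, hS⟩ := Set.exists_of_ssubset (hST.ssubset_of_ne hne)
  -- Particular-point topology at `h`: every set containing `h` is dense, while `{h}` is an open set
  -- missing `S`.
  let τ : TopologicalSpace α :=
    { IsOpen := fun U => U.Nonempty → h ∈ U
      isOpen_univ := fun _ => trivial
      isOpen_inter := fun U V hU hV ⟨x, hx⟩ => ⟨hU ⟨x, hx.1⟩, hV ⟨x, hx.2⟩⟩
      isOpen_sUnion := fun 𝒰 h𝒰 ⟨x, U, hU, hx⟩ => ⟨U, hU, h𝒰 U hU ⟨x, hx⟩⟩ }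
  refine ⟨τ, dense_iff_inter_open.2 fun U hU hUne => ⟨h, hU hUne, hT⟩, fun hd => ?_⟩
  obtain ⟨x, rfl, hx⟩ := dense_iff_inter_open.1 hd {h} (fun _ => rfl) ⟨h, rfl⟩
  exact hS hx

end Architope

theorem mainTheorem10 (d s : ℕ) (hs : 2 ≤ s) (hsd : s ≤ d)
    (p : ℝ≥0∞) [Fact (1 ≤ p)] (hp : p ≠ ∞)
    (μ : Measure (Fin d → ℝ)) [SigmaFinite μ] (hμ : μ ≪ volume)
    (K : ℕ → Set (Fin d → ℝ)) (hK : Architope.IsPartition μ K)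
    (hKμ : ∀ n, 0 < μ (K n) ∧ μ (K n) < ∞) :
    -- density of the networks in `L^p_ν`, for finite compactly supported `ν`
    (∀ (ν : Measure (Fin d → ℝ)) [IsFiniteMeasure ν] (C : Set (Fin d → ℝ)),
      IsCompact C → ν Cᶜ = 0 →
      Dense {g : Lp ℝ p ν | ∃ f ∈ Architope.Conv d s, g =ᵐ[ν] f}) ∧
    -- (i) density of the architopes in the strict space
    @Dense _ (Architope.strictTopology ℝ p μ K) (Architope.tope p μ K (Architope.Conv d s)) ∧
    -- (ii) approximation of `L^p_μ` functions by architopes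
    (∀ f : (Fin d → ℝ) → ℝ, MemLp f p μ → ∀ δ : ℝ, 0 < δ →
      ∃ g ∈ Architope.tope p μ K (Architope.Conv d s),
        ∫⁻ x, ‖f x - g.1 x‖ₑ ^ p.toReal ∂μ < ENNReal.ofReal δ) ∧
    -- (iii) the architopes are dense whenever the networks are
    (∀ τ : TopologicalSpace (Architope.LpLoc ℝ p μ),
      @Dense _ τ (Architope.classIn p μ (Architope.Conv d s)) →
      @Dense _ τ (Architope.tope p μ K (Architope.Conv d s))) ∧
    -- (iii) the converse fails, provided that the two classes differ
    (Architope.classIn p μ (Architope.Conv d s) ≠ Architope.tope p μ K (Architope.Conv d s) →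
      ∃ τ : TopologicalSpace (Architope.LpLoc ℝ p μ),
        @Dense _ τ (Architope.tope p μ K (Architope.Conv d s)) ∧
        ¬ @Dense _ τ (Architope.classIn p μ (Architope.Conv d s))) ∧
    -- the two classes do differ when `μ` has full support
    (μ.IsOpenPosMeasure →
      Architope.classIn p μ (Architope.Conv d s) ≠
        Architope.tope p μ K (Architope.Conv d s)) := by
  have hd : 0 < d := by omega
  have hKfin : ∀ n, μ (K n) < ∞ := fun n => (hKμ n).2
  have hsub := Architope.classIn_subset_tope (p := p) (μ := μ) (K := K) (Architope.Conv d s)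
  refine ⟨fun ν _ C hC hνC => Architope.dense_Conv_Lp hd hs hp ν hC hνC,
    Architope.dense_tope_strict hd hs hp hK hKfin,
    fun f hf δ hδ => Architope.exists_mem_tope_lintegral_lt hd hs hp Fact.out hK hKfin hf hδ,
    fun τ h => h.mono hsub, fun hne => Architope.exists_topology_dense_not_dense hsub hne,
    fun _ => Architope.classIn_ne_tope hd hK hKμ (Architope.one_mem_Conv d s)⟩
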